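/- \textbf{Model.} A credit network consists of a finite simple undirected graph $G=(V,E)$ and, for each edge $\{u,v\}$, an integer total credit capacity $c_{\{u,v\}}\ge 1$. A \emph{state} assigns to each edge $\{u,v\}$ integers $c_{uv},c_{vu}\ge 0$ with $c_{uv}+c_{vu}=c_{\{u,v\}}$, where $c_{uv}$ is the credit that $u$ currently extends to $v$. A unit payment from $s$ to $t$ is \emph{feasible} in a state if there is a path $s=x_0,x_1,\dots,x_k=t$ of distinct nodes in $G$ with $c_{x_{i+1}x_i}\ge 1$ for all $0\le i<k$ (a feasible path). Routing the payment along this path increases each $c_{x_ix_{i+1}}$ by $1$ and decreases each $c_{x_{i+1}x_i}$ by $1$. Let $\Lambda=(\lambda_{uv})_{u,v\in V}$ be a transaction rate matrix: $\lambda_{uv}\ge 0$, $\lambda_{uu}=0$ and $\sum_{u,v}\lambda_{uv}=1$. The Markov chain $\mathcal M(G,\Lambda)$ on the finite set of states is as follows. At each time step a pair $(s,t)$ is chosen with probability $\lambda_{st}$; if a unit payment from $s$ to $t$ is feasible in the current state, it is routed along a shortest feasible path, and otherwise the state does not change. Ties between shortest feasible paths are broken by an arbitrary fixed rule, which may depend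 on the state and on $(s,t)$. The chain is \emph{ergodic} if it is irreducible and aperiodic on the set of all states. A node $v$ is \emph{bankrupt} in a state if $c_{uv}=0$ for every neighbour $u$ of $v$, that is, if no node extends any credit to $v$. \textbf{Theorem.} Suppose that $\Lambda$ is symmetric and that $\mathcal M(G,\Lambda)$ is ergodic. Then $\mathcal M(G,\Lambda)$ has a unique stationary (steady-state) distribution $\pi$, and for every vertex $v\in V$ the steady-state probability that $v$ is bankrupt satisfies $$\pi\bigl(\{\text{states in which } v \text{ is bankrupt}\}\bigr)\;\le\;\frac{1}{d_v+1},\qquad d_v=\sum_{u:\{u,v\}\in E}c_{\{u,v\}}=\sum_{u:\{u,v\}\in E}(c_{uv}+c_{vu}).$$ -/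

import Mathlib

/-- The time-invariant part of a credit network on the vertex set `V`: the total integral credit
capacity of each pair of nodes, which is the same in both orders and zero on the diagonal.
A pair of nodes is an edge when its total capacity is positive. -/
structure CreditNetwork (V : Type*) where
  capacity : V → V → ℕ
  capacity_symm : ∀ u v, capacity u v = capacity v u
  capacity_self : ∀ v, capacity v v = 0

namespace CreditNetwork

variable {V : Type*}

/-- The underlying undirected graph. -/
def graph (N : CreditNetwork V) : SimpleGraph V where
  Adj u v := 0 < N.capacity u v
  symm := ⟨fun u v h => by rw [N.capacity_symm]; exact h⟩
  loopless := ⟨fun v h => by rw [N.capacity_self] at h; exact lt_irrefl 0 h⟩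

/-- The total credit capacity `d_v` of all edges incident to `v`. -/
def totalCapacity [Fintype V] (N : CreditNetwork V) (v : V) : ℕ :=
  ∑ u, N.capacity v u

/-- A state of the network: `credit u v` is the (integral) credit currently extended by `u`
to `v`; the two directions of a pair always add up to its total capacity. -/
@[ext] structure State (N : CreditNetwork V) where
  credit : V → V → ℕ
  credit_add : ∀ u v, credit u v + credit v u = N.capacity u v

instance State.finite [Finite V] (N : CreditNetwork V) : Finite N.State := by
  refine Finite.of_injective
    (β := (p : V × V) → Fin (N.capacity p.1 p.2 + 1))
    (fun S p => ⟨S.credit p.1 p.2, by have := S.credit_add p.1 p.2; omega⟩) ?_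
  intro S T h
  ext u v
  have := congrFun h (u, v)
  simpa using this

noncomputable instance State.fintype [Finite V] (N : CreditNetwork V) : Fintype N.State :=
  Fintype.ofFinite _

noncomputable instance State.decidableEq (N : CreditNetwork V) : DecidableEq N.State :=
  Classical.decEq _

/-- The walk `p` traverses the pair `u, v` in the direction from `u` to `v`. -/
def Traverses {N : CreditNetwork V} {s t : V} (p : N.graph.Walk s t) (u v : V) : Prop :=
  ∃ d ∈ p.darts, d.fst = u ∧ d.snd = v

theorem not_traverses_both {N : CreditNetwork V} {s t : V} {p : N.graph.Walk s t}
    (hp : p.IsPath) {u v : V} (huv : Traverses p u v) : ¬ Traverses p v u := by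
  rintro ⟨e, he, he1, he2⟩
  obtain ⟨d, hd, hd1, hd2⟩ := huv
  have hnd : (p.darts.map SimpleGraph.Dart.edge).Nodup := hp.isTrail.edges_nodup
  have hed : d.edge = e.edge := by
    rw [SimpleGraph.dart_edge_eq_iff]
    right
    ext <;> simp [hd1, hd2, he1, he2]
  have hde : d = e := List.inj_on_of_nodup_map hnd hd he hed
  have hne := N.graph.ne_of_adj d.adj
  subst hde
  exact hne (hd1.trans he2.symm)

namespace State

variable {N : CreditNetwork V}

/-- A unit payment from `s` to `t` can be routed along `p`: `p` is a path, and for each of its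
steps from `u` to `v` the receiving node `v` currently extends positive credit to `u`. -/
def IsFeasiblePath (S : N.State) {s t : V} (p : N.graph.Walk s t) : Prop :=
  p.IsPath ∧ ∀ u v, Traverses p u v → 0 < S.credit v u

/-- A feasible path of minimal length among the feasible paths from `s` to `t`. -/
def IsShortestFeasiblePath (S : N.State) {s t : V} (p : N.graph.Walk s t) : Prop :=
  S.IsFeasiblePath p ∧ ∀ q : N.graph.Walk s t, S.IsFeasiblePath q → p.length ≤ q.length

/-- A unit payment from `s` to `t` is feasible. -/
def Feasible (S : N.State) (s t : V) : Prop :=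
  ∃ p : N.graph.Walk s t, S.IsFeasiblePath p

open Classical in
/-- The state after routing a unit payment along a feasible path: for each step of the path
from `u` to `v`, the credit from `u` to `v` goes up by one and that from `v` to `u` goes down
by one. -/
noncomputable def pay (S : N.State) {s t : V} (p : N.graph.Walk s t) (hp : S.IsFeasiblePath p) :
    N.State where
  credit u v :=
    S.credit u v + (if Traverses p u v then 1 else 0) - (if Traverses p v u then 1 else 0)
  credit_add u v := by
    have h := S.credit_add u v
    by_cases h1 : Traverses p u v
    · have h2 := not_traverses_both hp.1 h1
      have h3 := hp.2 u v h1
      simp only [h1, h2, if_true, if_false]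
      omega
    · by_cases h2 : Traverses p v u
      · have h3 := hp.2 v u h2
        simp only [h1, h2, if_true, if_false]
        omega
      · simp only [h1, h2, if_false]
        omega

/-- The node `v` is bankrupt: no node extends any credit to it. -/
def Bankrupt (S : N.State) (v : V) : Prop :=
  ∀ u, S.credit u v = 0

end State

/-- A choice, for every state and every feasible transaction, of one shortest feasible path
(that is, a way of breaking ties between shortest feasible paths). -/
structure Routing (N : CreditNetwork V) where
  path : ∀ (S : N.State) (s t : V), S.Feasible s t → N.graph.Walk s t
  path_spec : ∀ (S : N.State) (s t : V) (h : S.Feasible s t),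
    S.IsShortestFeasiblePath (path S s t h)

open Classical in
/-- The state after the transaction `(s, t)` is attempted: a failed transaction changes
nothing. -/
noncomputable def Routing.step {N : CreditNetwork V} (R : N.Routing) (S : N.State) (s t : V) :
    N.State :=
  if h : S.Feasible s t then S.pay (R.path S s t h) (R.path_spec S s t h).1 else S

/-- The transition matrix of the Markov chain on the states of the network: at each time step
the transaction `(s, t)` is attempted with probability `Λ s t`. -/
noncomputable def Routing.transitionMatrix [Fintype V] {N : CreditNetwork V} (R : N.Routing)
    (Λ : Matrix V V ℝ) : Matrix N.State N.State ℝ :=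
  Matrix.of fun S S' => ∑ s, ∑ t, if R.step S s t = S' then Λ s t else 0

end CreditNetwork

/-- A matrix of transaction rates: the entries are the probabilities of the transactions, and
no node transacts with itself. -/
structure IsTransactionMatrix {V : Type*} [Fintype V] (Λ : Matrix V V ℝ) : Prop where
  nonneg : ∀ u v, 0 ≤ Λ u v
  diag : ∀ v, Λ v v = 0
  sum_eq_one : ∑ u, ∑ v, Λ u v = 1

/-- Ergodicity of a finite Markov chain with transition matrix `P`: the chain is irreducible
and every state has period one. -/
structure IsErgodicChain {σ : Type*} [Fintype σ] [DecidableEq σ] (P : Matrix σ σ ℝ) : Prop where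
  irreducible : P.IsIrreducible
  aperiodic : ∀ i, Nat.setGcd {k : ℕ | 0 < k ∧ 0 < (P ^ k) i i} = 1

/-- `π` is a steady-state (stationary) probability distribution of the finite Markov chain with
transition matrix `P`. -/
structure IsSteadyState {σ : Type*} [Fintype σ] (P : Matrix σ σ ℝ) (π : σ → ℝ) : Prop where
  mem_stdSimplex : π ∈ stdSimplex ℝ σ
  stationary : Matrix.vecMul π P = π

/-! ### Finite Markov chains -/

namespace Matrix

variable {σ : Type*} [Fintype σ] [DecidableEq σ] {P : Matrix σ σ ℝ}

/-! Attach to a state its score vector, the total credit extended to each node. A payment from `s`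
to `t` changes it by `shift s t`, whatever the route (`score_pay`). By a cut argument, feasibility
also depends on the score alone (`feasible_of_score_eq`). So the chain projects to a walk on scores
that attempts the step `shift s t` at rate `Λ s t` and stays put if the target is not a score. For
symmetric `Λ` this walk is symmetric, so stationary score masses, read as a function of the state,
are harmonic, hence constant by irreducibility: the steady state is uniform on scores.

Bankruptcy of `v` means that the score of `v` is zero. From each such score, handing `k` units of
credit to `v`, for `0 ≤ k ≤ d_v`, gives `d_v + 1` scores, all distinct as the starting score and `k`
vary. Hence the bankrupt scores form at most a fraction `1 / (d_v + 1)` of all scores. -/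

theorem pow_mulVec_eq_self {h : σ → ℝ} (hh : P *ᵥ h = h) (k : ℕ) : (P ^ k) *ᵥ h = h := by
  induction k with
  | zero => simp
  | succ k ih => rw [pow_succ, ← mulVec_mulVec, hh, ih]

theorem vecMul_pow_eq_self {x : σ → ℝ} (hx : x ᵥ* P = x) (k : ℕ) : x ᵥ* (P ^ k) = x := by
  induction k with
  | zero => simp
  | succ k ih => rw [pow_succ, ← vecMul_vecMul, ih, hx]

/-- Harmonic functions of an irreducible stochastic matrix are constant. -/
theorem IsIrreducible.eq_of_mulVec_eq_self (hP : P.IsIrreducible) (h1 : P *ᵥ 1 = 1)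
    {h : σ → ℝ} (hh : P *ᵥ h = h) (i j : σ) : h i = h j := by
  have : Nonempty σ := ⟨i⟩
  obtain ⟨m, hm⟩ := Finite.exists_max h
  suffices key : ∀ l, h l = h m by rw [key i, key j]
  intro l
  obtain ⟨k, -, hk⟩ := (isIrreducible_iff_exists_pow_pos hP.nonneg).1 hP m l
  have e1 : ∑ a, (P ^ k) m a * 1 = 1 := by
    simpa [mulVec, dotProduct] using congrFun (pow_mulVec_eq_self h1 k) m
  have e2 : ∑ a, (P ^ k) m a * h a = h m := congrFun (pow_mulVec_eq_self hh k) m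
  -- Maximum principle: `h m` is an average of values at most `h m`, and `l` carries positive
  -- weight.
  have e3 : ∑ a, (P ^ k) m a * (h m - h a) = 0 := by
    simp only [mul_one] at e1
    simp only [mul_sub, Finset.sum_sub_distrib, e2, ← Finset.sum_mul, e1]
    ring
  have e4 := (Finset.sum_eq_zero_iff_of_nonneg fun a _ =>
    mul_nonneg (pow_apply_nonneg hP.nonneg k m a) (sub_nonneg.2 (hm a))).1 e3 l
      (Finset.mem_univ l)
  rcases mul_eq_zero.1 e4 with h0 | h0 <;> linarith

theorem IsIrreducible.eq_zero_of_vecMul_eq_self (hP : P.IsIrreducible)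
    {y : σ → ℝ} (hy : y ᵥ* P = y) (h0 : ∀ i, 0 ≤ y i) {i : σ} (hi : y i = 0) : y = 0 := by
  ext j
  obtain ⟨k, -, hk⟩ := (isIrreducible_iff_exists_pow_pos hP.nonneg).1 hP j i
  have e : ∑ a, y a * (P ^ k) a i = 0 := (congrFun (vecMul_pow_eq_self hy k) i).trans hi
  have e4 := (Finset.sum_eq_zero_iff_of_nonneg fun a _ =>
    mul_nonneg (h0 a) (pow_apply_nonneg hP.nonneg k a i)).1 e j (Finset.mem_univ j)
  rcases mul_eq_zero.1 e4 with h | h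
  · exact h
  · exact absurd h hk.ne'

omit [DecidableEq σ] in
theorem sum_vecMul_of_mulVec_one (h1 : P *ᵥ 1 = 1) (x : σ → ℝ) :
    ∑ i, (x ᵥ* P) i = ∑ i, x i := by
  have := dotProduct_mulVec x P 1
  rw [h1] at this
  simpa [dotProduct] using this.symm

-- The triangle inequality gives `≤` in each coordinate; both sides have the same sum because rows
-- sum to one, so equality holds throughout.
omit [DecidableEq σ] in
theorem abs_vecMul_eq_self (hP : ∀ i j, 0 ≤ P i j) (h1 : P *ᵥ 1 = 1) {x : σ → ℝ}
    (hx : x ᵥ* P = x) : (fun i => |x i|) ᵥ* P = fun i => |x i| := by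
  have hle : ∀ i, |x i| ≤ ((fun i => |x i|) ᵥ* P) i := fun i => by
    calc |x i| = |∑ a, x a * P a i| := by rw [← congrFun hx i]; rfl
      _ ≤ ∑ a, |x a * P a i| := Finset.abs_sum_le_sum_abs _ _
      _ = ∑ a, |x a| * P a i := by simp only [abs_mul, abs_of_nonneg (hP _ _)]
  have hsum := sum_vecMul_of_mulVec_one h1 fun i => |x i|
  ext i
  exact ((Finset.sum_eq_sum_iff_of_le fun i _ => hle i).1 hsum.symm i (Finset.mem_univ i)).symm

end Matrix

/-- The constant vector puts `P - 1` in the singular case, so there is also a nonzero left fixed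
vector; its absolute value, normalised, is the distribution. -/
theorem exists_isSteadyState {σ : Type*} [Fintype σ] [DecidableEq σ] [Nonempty σ]
    {P : Matrix σ σ ℝ} (hP : ∀ i j, 0 ≤ P i j) (h1 : P.mulVec 1 = 1) :
    ∃ π, IsSteadyState P π := by
  have hdet : (P - 1).det = 0 := Matrix.exists_mulVec_eq_zero_iff.1
    ⟨1, one_ne_zero, by rw [Matrix.sub_mulVec, h1, Matrix.one_mulVec, sub_self]⟩
  obtain ⟨x, hx0, hx⟩ := Matrix.exists_vecMul_eq_zero_iff.2 hdet
  rw [Matrix.vecMul_sub, Matrix.vecMul_one, sub_eq_zero] at hx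
  have habs := Matrix.abs_vecMul_eq_self hP h1 hx
  have hpos : 0 < ∑ i, |x i| := by
    obtain ⟨i, hi⟩ := Function.ne_iff.1 hx0
    exact Finset.sum_pos' (fun i _ => abs_nonneg _) ⟨i, Finset.mem_univ i, abs_pos.2 hi⟩
  refine ⟨(∑ i, |x i|)⁻¹ • fun i => |x i|, ⟨fun i => ?_, ?_⟩, ?_⟩
  · exact mul_nonneg (inv_nonneg.2 hpos.le) (abs_nonneg _)
  · simp only [Pi.smul_apply, smul_eq_mul, ← Finset.mul_sum]
    exact inv_mul_cancel₀ hpos.ne'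
  · rw [Matrix.smul_vecMul, habs]

theorem IsSteadyState.unique {σ : Type*} [Fintype σ] [DecidableEq σ] [Nonempty σ]
    {P : Matrix σ σ ℝ} (hP : P.IsIrreducible) (h1 : P.mulVec 1 = 1) {π ρ : σ → ℝ}
    (hπ : IsSteadyState P π) (hρ : IsSteadyState P ρ) : π = ρ := by
  set x : σ → ℝ := π - ρ with hx
  have hxP : Matrix.vecMul x P = x := by
    rw [hx, Matrix.sub_vecMul, hπ.stationary, hρ.stationary]
  have hsum : ∑ i, x i = 0 := by
    simp [hx, Finset.sum_sub_distrib, hπ.mem_stdSimplex.2, hρ.mem_stdSimplex.2]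
  -- This nonnegative fixed vector vanishes wherever `x i ≥ 0`, which happens somewhere as `x` sums
  -- to zero. So it is zero, and `x` is nonnegative with zero sum.
  have hy : Matrix.vecMul ((fun i => |x i|) - x) P = (fun i => |x i|) - x := by
    rw [Matrix.sub_vecMul, hxP, Matrix.abs_vecMul_eq_self hP.nonneg h1 hxP]
  obtain ⟨i, -, hi⟩ : ∃ i ∈ Finset.univ, 0 ≤ x i :=
    Finset.exists_le_of_sum_le Finset.univ_nonempty (by simp [hsum])
  have hzero := hP.eq_zero_of_vecMul_eq_self hy (fun j => sub_nonneg.2 (le_abs_self _))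
    (i := i) (by simp [abs_of_nonneg hi])
  have hnn : ∀ j, 0 ≤ x j := fun j => by
    have := congrFun hzero j
    simp only [Pi.sub_apply, Pi.zero_apply, sub_eq_zero] at this
    exact this ▸ abs_nonneg _
  ext j
  have := (Finset.sum_eq_zero_iff_of_nonneg fun j _ => hnn j).1 hsum j (Finset.mem_univ j)
  simpa [hx, sub_eq_zero] using this

/-! ### Scores of states -/

namespace CreditNetwork

variable {V : Type*} {N : CreditNetwork V}

theorem nonempty_state (N : CreditNetwork V) : Nonempty N.State := by
  classical
  obtain ⟨r, hr⟩ := exists_wellFoundedLT V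
  -- A linear order orients every edge; the smaller endpoint extends all the credit.
  refine ⟨⟨fun u v => if u < v then N.capacity u v else 0, fun u v => ?_⟩⟩
  rcases lt_trichotomy u v with h | rfl | h
  · simp [h, h.not_gt]
  · simp [N.capacity_self]
  · simp [h, h.not_gt, N.capacity_symm u v]

theorem traverses_cons {u x t : V} (h : N.graph.Adj u x) (p : N.graph.Walk x t) (a b : V) :
    Traverses (SimpleGraph.Walk.cons h p) a b ↔ (a = u ∧ b = x) ∨ Traverses p a b := by
  simp only [Traverses, SimpleGraph.Walk.darts_cons, List.mem_cons, exists_eq_or_imp]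
  simp only [eq_comm]

theorem Traverses.mem_support {u t : V} {p : N.graph.Walk u t} {a b : V} (h : Traverses p a b) :
    a ∈ p.support ∧ b ∈ p.support := by
  obtain ⟨d, hd, rfl, rfl⟩ := h
  exact ⟨p.dart_fst_mem_support_of_mem_darts hd, p.dart_snd_mem_support_of_mem_darts hd⟩

open Classical in
/-- The net flow of a path into a vertex. -/
theorem sum_traverses_sub [Fintype V] {s t : V} {p : N.graph.Walk s t} (hp : p.IsPath) (v : V) :
    ∑ u, ((if Traverses p u v then (1 : ℤ) else 0) - (if Traverses p v u then 1 else 0)) =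
      (if v = t then 1 else 0) - (if v = s then 1 else 0) := by
  induction p with
  | nil => simp [Traverses]
  | @cons a b t h p ih =>
    rw [SimpleGraph.Walk.cons_isPath_iff] at hp
    have key : ∀ c d, (if Traverses (SimpleGraph.Walk.cons h p) c d then (1 : ℤ) else 0) =
        (if c = a ∧ d = b then 1 else 0) + (if Traverses p c d then 1 else 0) := fun c d => by
      by_cases hcd : c = a ∧ d = b
      -- A path does not return to its first vertex, so the two indicators never overlap.
      · have : ¬ Traverses p c d := fun ht => hp.2 (hcd.1 ▸ ht.mem_support.1)
        simp [traverses_cons, hcd, hcd.1 ▸ hcd.2 ▸ this]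
      · simp [traverses_cons, hcd]
    have e1 : ∑ u, (if u = a ∧ v = b then (1 : ℤ) else 0) = if v = b then 1 else 0 := by
      by_cases hv : v = b <;> simp [hv]
    have e2 : ∑ u, (if v = a ∧ u = b then (1 : ℤ) else 0) = if v = a then 1 else 0 := by
      by_cases hv : v = a <;> simp [hv]
    have ih' := ih hp.1
    simp only [Finset.sum_sub_distrib] at ih'
    simp only [key, Finset.sum_sub_distrib, Finset.sum_add_distrib, e1, e2]
    linarith

namespace State

/-- The total credit extended to each node. -/
def score [Fintype V] (S : N.State) (v : V) : ℤ := ∑ u, (S.credit u v : ℤ)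

open Classical in
/-- The change of the scores caused by a unit payment from `s` to `t`. -/
noncomputable def shift (s t : V) : V → ℤ := Pi.single t 1 - Pi.single s 1

theorem shift_swap (s t : V) : shift t s = -shift s t := by simp [shift]

/-- At an inner vertex of the path, the step in and the step out cancel. -/
theorem score_pay [Fintype V] (S : N.State) {s t : V} (p : N.graph.Walk s t)
    (hp : S.IsFeasiblePath p) : (S.pay p hp).score = S.score + shift s t := by
  classical
  ext v
  have h2 : shift s t v = (if v = t then 1 else 0) - (if v = s then 1 else 0) := by
    simp only [shift, Pi.sub_apply, Pi.single_apply]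
  rw [Pi.add_apply, h2, ← sum_traverses_sub hp.1 v, score, score, ← Finset.sum_add_distrib]
  refine Finset.sum_congr rfl fun u _ => ?_
  simp only [pay]
  by_cases h : Traverses p v u
  -- Feasibility makes the truncated subtraction in `pay` exact.
  · have h3 := hp.2 v u h
    have h4 := not_traverses_both hp.1 h
    simp only [h, h4, if_true, if_false]
    omega
  · simp only [h, if_false]
    split_ifs <;> simp

/-- Deleting the cycles of a walk uses no new darts, so the credits along it stay positive. -/
theorem feasible_of_reflTransGen (S : N.State) {s t : V}
    (h : Relation.ReflTransGen (fun u w => 0 < S.credit w u) s t) : S.Feasible s t := by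
  classical
  have key : ∃ p : N.graph.Walk s t, ∀ u v, Traverses p u v → 0 < S.credit v u := by
    induction h using Relation.ReflTransGen.head_induction_on with
    | refl => exact ⟨SimpleGraph.Walk.nil, by simp [Traverses]⟩
    | @head a b hab _ ih =>
      obtain ⟨p, hp⟩ := ih
      have hadj : N.graph.Adj a b := by
        have := S.credit_add a b
        change 0 < N.capacity a b
        omega
      refine ⟨SimpleGraph.Walk.cons hadj p, fun u v huv => ?_⟩
      rcases (traverses_cons hadj p u v).1 huv with ⟨rfl, rfl⟩ | h
      · exact hab
      · exact hp u v h
  obtain ⟨p, hp⟩ := key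
  refine ⟨p.bypass, p.bypass_isPath, fun u v ⟨d, hd, hd'⟩ => hp u v ⟨d, ?_, hd'⟩⟩
  exact p.darts_bypass_subset_darts hd

-- The credit internal to `A` is therefore the same in all states.
open Classical in
theorem two_mul_sum_credit (S : N.State) (A : Finset V) :
    2 * ∑ v ∈ A, ∑ u ∈ A, (S.credit u v : ℤ) = ∑ v ∈ A, ∑ u ∈ A, (N.capacity u v : ℤ) := by
  rw [two_mul]
  nth_rewrite 2 [Finset.sum_comm]
  simp only [← Finset.sum_add_distrib]
  refine Finset.sum_congr rfl fun v _ => Finset.sum_congr rfl fun u _ => ?_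
  exact_mod_cast S.credit_add u v

/-- A payment is feasible as soon as some state has the scores that it would produce. -/
theorem feasible_of_score_eq [Fintype V] {S T : N.State} {s t : V}
    (h : T.score = S.score + shift s t) : S.Feasible s t := by
  classical
  refine S.feasible_of_reflTransGen ?_
  by_contra ht
  -- Cut argument: no node outside the set `A` reachable from `s` extends credit into `A`, so the
  -- scores of `S` on `A` add up to the internal credit, a lower bound for every state. As `s` is in
  -- `A` and `t` is not, `T` would fall one below it.
  set A : Finset V := Finset.univ.filter
    (fun u => Relation.ReflTransGen (fun u w => 0 < S.credit w u) s u) with hA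
  have hsA : s ∈ A := by simp [hA, Relation.ReflTransGen.refl]
  have htA : t ∉ A := by simpa [hA] using ht
  have e1 : ∑ v ∈ A, S.score v = ∑ v ∈ A, ∑ u ∈ A, (S.credit u v : ℤ) := by
    refine Finset.sum_congr rfl fun v hv => ?_
    refine (Finset.sum_subset (Finset.subset_univ A) fun u _ hu => ?_).symm
    by_contra h0
    refine hu (Finset.mem_filter.2 ⟨Finset.mem_univ u, ?_⟩)
    refine (Finset.mem_filter.1 hv).2.tail ?_
    have : S.credit u v ≠ 0 := by exact_mod_cast h0
    omega
  have e2 : ∑ v ∈ A, ∑ u ∈ A, (T.credit u v : ℤ) ≤ ∑ v ∈ A, T.score v :=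
    Finset.sum_le_sum fun v _ => Finset.sum_le_sum_of_subset_of_nonneg
      (Finset.subset_univ A) fun u _ _ => Int.natCast_nonneg _
  have e3 : ∑ v ∈ A, T.score v = ∑ v ∈ A, S.score v - 1 := by
    have hsh : ∀ v, shift s t v = (if t = v then 1 else 0) - (if s = v then 1 else 0) := by
      intro v
      simp only [shift, Pi.sub_apply, Pi.single_apply, eq_comm]
    simp only [h, Pi.add_apply, Finset.sum_add_distrib, hsh, Finset.sum_sub_distrib,
      Finset.sum_ite_eq, hsA, htA, if_true, if_false]
    ring
  have e4 := S.two_mul_sum_credit A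
  have e5 := T.two_mul_sum_credit A
  linarith

theorem feasible_iff [Fintype V] (S : N.State) (s t : V) :
    S.Feasible s t ↔ ∃ T : N.State, T.score = S.score + shift s t :=
  ⟨fun ⟨p, hp⟩ => ⟨S.pay p hp, S.score_pay p hp⟩, fun ⟨_, h⟩ => feasible_of_score_eq h⟩

theorem Bankrupt.score_eq_zero [Fintype V] {S : N.State} {v : V} (h : S.Bankrupt v) :
    S.score v = 0 := by simp [score, h _]

theorem bankrupt_of_score_eq_zero [Fintype V] {S : N.State} {v : V} (h : S.score v = 0) :
    S.Bankrupt v := fun u => by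
  have := (Finset.sum_eq_zero_iff_of_nonneg fun u _ => Int.natCast_nonneg _).1 h u
    (Finset.mem_univ u)
  exact_mod_cast this

end State

open Classical in
theorem Routing.score_step [Fintype V] (R : N.Routing) (S : N.State) (s t : V) :
    (R.step S s t).score = if S.Feasible s t then S.score + State.shift s t else S.score := by
  by_cases h : S.Feasible s t
  · simp only [Routing.step, h, dif_pos, if_true, State.score_pay]
  · simp only [Routing.step, h, dif_neg, not_false_eq_true, if_false]

/-! ### The steady state is uniform on scores -/

open Classical in
theorem Routing.transitionMatrix_mulVec [Fintype V] (R : N.Routing) (Λ : Matrix V V ℝ)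
    (h : N.State → ℝ) (S : N.State) :
    (R.transitionMatrix Λ).mulVec h S = ∑ s, ∑ t, Λ s t * h (R.step S s t) := by
  simp only [Matrix.mulVec, dotProduct, Routing.transitionMatrix, Matrix.of_apply,
    Finset.sum_mul, ite_mul, zero_mul]
  rw [Finset.sum_comm]
  refine Finset.sum_congr rfl fun s _ => ?_
  rw [Finset.sum_comm]
  exact Finset.sum_congr rfl fun t _ => by simp

theorem Routing.transitionMatrix_mulVec_one [Fintype V] (R : N.Routing) {Λ : Matrix V V ℝ}
    (hΛ : IsTransactionMatrix Λ) : (R.transitionMatrix Λ).mulVec 1 = 1 := by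
  ext S
  simp [R.transitionMatrix_mulVec, hΛ.sum_eq_one]

open Classical in
/-- The total weight of the states with the given scores. -/
noncomputable def scoreMass [Fintype V] (π : N.State → ℝ) (σ : V → ℤ) : ℝ :=
  ∑ S, if S.score = σ then π S else 0

theorem scoreMass_eq_zero [Fintype V] (π : N.State → ℝ) {σ : V → ℤ}
    (h : ¬ ∃ S : N.State, S.score = σ) : scoreMass π σ = 0 :=
  Finset.sum_eq_zero fun S _ => if_neg fun hS => h ⟨S, hS⟩

-- Mass enters the score class of `S₀` from the class one payment earlier, all of whose members can
-- make that payment since `S₀` has the resulting score, or stays in the class when the payment is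
-- infeasible there.
open Classical in
theorem Routing.sum_score_step_eq [Fintype V] (R : N.Routing) (π : N.State → ℝ) (S₀ : N.State)
    (s t : V) :
    (∑ S, if (R.step S s t).score = S₀.score then π S else 0) =
      scoreMass π (S₀.score + State.shift t s) +
        if S₀.Feasible s t then 0 else scoreMass π S₀.score := by
  have hneg : ∀ S : N.State, S.score + State.shift s t = S₀.score ↔
      S.score = S₀.score + State.shift t s := fun S => by
    rw [State.shift_swap s t, ← sub_eq_add_neg, eq_sub_iff_add_eq]
  have hfeas : ∀ S : N.State, S.score = S₀.score → (S.Feasible s t ↔ S₀.Feasible s t) :=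
    fun S hS => by rw [State.feasible_iff, State.feasible_iff, hS]
  have h1 : (if S₀.Feasible s t then 0 else scoreMass π S₀.score) =
      ∑ S : N.State, if S₀.Feasible s t then 0 else if S.score = S₀.score then π S else 0 := by
    split_ifs
    · simp
    · rfl
  rw [h1, scoreMass, ← Finset.sum_add_distrib]
  refine Finset.sum_congr rfl fun S _ => ?_
  rw [R.score_step]
  by_cases hS : S.Feasible s t
  · rw [if_pos hS]
    simp only [hneg]
    by_cases hS' : S.score = S₀.score
    · simp [(hfeas S hS').1 hS]
    · simp [hS']
  · have h2 : S.score ≠ S₀.score + State.shift t s := fun h =>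
      hS (State.feasible_of_score_eq ((hneg S).2 h).symm)
    rw [if_neg hS, if_neg h2, zero_add]
    by_cases hS' : S.score = S₀.score
    · simp [hS', (hfeas S hS').not.1 hS]
    · simp [hS']

-- Written so that it differs from `sum_score_step_eq` only in the direction of the shift. For an
-- infeasible payment the shifted vector is not a score and has mass zero.
open Classical in
theorem Routing.scoreMass_score_step [Fintype V] (R : N.Routing) (π : N.State → ℝ)
    (S : N.State) (s t : V) :
    scoreMass π (R.step S s t).score = scoreMass π (S.score + State.shift s t) +
      if S.Feasible s t then 0 else scoreMass π S.score := by
  rw [R.score_step]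
  by_cases h : S.Feasible s t
  · simp [h]
  · simp [h, scoreMass_eq_zero π (mt (S.feasible_iff s t).2 h)]

/-- For symmetric transaction rates, the score weights of a steady state are harmonic. -/
theorem Routing.scoreMass_harmonic [Fintype V] (R : N.Routing) {Λ : Matrix V V ℝ}
    (hsymm : Λ.IsSymm) {π : N.State → ℝ}
    (hπ : Matrix.vecMul π (R.transitionMatrix Λ) = π) :
    (R.transitionMatrix Λ).mulVec (fun S => scoreMass π S.score) =
      fun S => scoreMass π S.score := by
  classical
  ext S₀
  symm
  have h1 : scoreMass π S₀.score =
      ∑ s, ∑ t, Λ s t * ∑ S, if (R.step S s t).score = S₀.score then π S else 0 := by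
    -- Stationarity is tested against the indicator of the score class of `S₀`.
    have h2 := Matrix.dotProduct_mulVec π (R.transitionMatrix Λ)
      (fun S => if S.score = S₀.score then 1 else 0)
    rw [hπ] at h2
    simp only [dotProduct, R.transitionMatrix_mulVec, mul_ite, mul_one, mul_zero] at h2
    rw [scoreMass, ← h2]
    simp only [Finset.mul_sum]
    rw [Finset.sum_comm]
    refine Finset.sum_congr rfl fun s _ => ?_
    rw [Finset.sum_comm]
    refine Finset.sum_congr rfl fun t _ => Finset.sum_congr rfl fun S _ => ?_
    split_ifs <;> ring
  rw [h1, R.transitionMatrix_mulVec]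
  simp only [R.sum_score_step_eq, R.scoreMass_score_step, mul_add, Finset.sum_add_distrib]
  -- The infeasible terms agree; the others are exchanged by swapping `s` and `t`, where the
  -- symmetry of `Λ` enters.
  congr 1
  rw [Finset.sum_comm]
  exact Finset.sum_congr rfl fun s _ => Finset.sum_congr rfl fun t _ => by rw [hsymm.apply]

/-! ### Counting scores -/

theorem exists_le_sum_eq {ι : Type*} [Fintype ι] (c : ι → ℕ) {k : ℕ} (hk : k ≤ ∑ i, c i) :
    ∃ x : ι → ℕ, (∀ i, x i ≤ c i) ∧ ∑ i, x i = k := by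
  classical
  induction k with
  | zero => exact ⟨0, by simp, by simp⟩
  | succ k ih =>
    obtain ⟨x, hx, hs⟩ := ih (by omega)
    obtain ⟨i, -, hi⟩ : ∃ i ∈ Finset.univ, x i < c i :=
      Finset.exists_lt_of_sum_lt (by omega)
    refine ⟨x + Pi.single i 1, fun j => ?_, ?_⟩
    · by_cases hj : j = i
      · subst hj; simpa using hi
      · simpa [hj] using hx j
    · simp [Finset.sum_add_distrib, hs]

open Classical in
/-- The scores of the states of the network. -/
noncomputable def scores [Fintype V] (N : CreditNetwork V) : Finset (V → ℤ) :=
  Finset.univ.image (State.score : N.State → V → ℤ)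

/-- Extending the credit `x` to a bankrupt node. -/
theorem State.exists_score_eq_of_bankrupt [Fintype V] [DecidableEq V] {S : N.State} {v : V}
    (hS : S.Bankrupt v) {x : V → ℕ} (hx : ∀ u, x u ≤ N.capacity v u) :
    ∃ T : N.State, T.score =
      S.score + (Pi.single v (∑ u, (x u : ℤ)) - fun u => (x u : ℤ)) := by
  have hxv : x v = 0 := by have := hx v; rw [N.capacity_self] at this; omega
  have hcap : ∀ u, S.credit v u = N.capacity v u := fun u => by
    have := S.credit_add v u
    rw [hS u] at this
    omega
  -- A bankrupt `v` extends the full capacity of each of its edges, so each node `u` can shift `x u`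
  -- of it back to `v`.
  refine ⟨⟨fun a b => if b = v then x a else if a = v then N.capacity v b - x b
    else S.credit a b, fun a b => ?_⟩, ?_⟩
  · by_cases ha : a = v <;> by_cases hb : b = v
    · subst ha; subst hb; simp [hxv, N.capacity_self]
    · subst ha
      have := hx b
      simp only [hb, if_true, if_false]
      omega
    · subst hb
      have := hx a
      rw [N.capacity_symm a b]
      simp only [ha, if_true, if_false]
      omega
    · simp only [ha, hb, if_false]
      exact S.credit_add a b
  · ext b
    by_cases hb : b = v
    · subst hb
      simp [State.score, hxv, hS _]
    · have h1 : ∀ a, ((if a = v then N.capacity v b - x b else S.credit a b : ℕ) : ℤ) =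
          S.credit a b - if a = v then (x b : ℤ) else 0 := fun a => by
        have := hx b
        by_cases ha : a = v
        · subst ha
          simp only [if_true, hcap]
          omega
        · simp [ha]
      simp only [State.score, hb, if_false, h1, Finset.sum_sub_distrib, Pi.add_apply,
        Pi.sub_apply, Pi.single_apply]
      simp
      ring

/-- Among the scores, at most a fraction `1 / (d_v + 1)` make `v` bankrupt. -/
theorem card_scores_bankrupt_mul_le [Fintype V] (N : CreditNetwork V) (v : V) :
    ((N.scores).filter (fun σ => σ v = 0)).card * (N.totalCapacity v + 1) ≤ N.scores.card := by
  classical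
  have hx : ∀ k : Fin (N.totalCapacity v + 1),
      ∃ x : V → ℕ, (∀ i, x i ≤ N.capacity v i) ∧ ∑ i, x i = k := fun k =>
    exists_le_sum_eq (N.capacity v) (Nat.lt_succ_iff.1 k.2)
  choose x hxle hxsum using hx
  rw [← Fintype.card_fin (N.totalCapacity v + 1), ← Finset.card_univ, ← Finset.card_product]
  have hxv : ∀ k, x k v = 0 := fun k => by
    have := hxle k v
    rw [N.capacity_self] at this
    omega
  -- The vector `x k` depends on `k` alone, and coordinate `v` of the image equals `k`; so the image
  -- determines `k`, then the bankrupt score.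
  refine Finset.card_le_card_of_injOn
    (fun q => q.1 + (Pi.single v (∑ u, (x q.2 u : ℤ)) - fun u => (x q.2 u : ℤ))) ?_ ?_
  · rintro ⟨σ, k⟩ hq
    simp only [Finset.coe_product, Set.mem_prod, Finset.mem_coe, Finset.mem_filter, scores,
      Finset.mem_image, Finset.mem_univ, true_and, and_true] at hq
    obtain ⟨⟨S, rfl⟩, h0⟩ := hq
    obtain ⟨T, hT⟩ := State.exists_score_eq_of_bankrupt
      (State.bankrupt_of_score_eq_zero h0) (hxle k)
    exact Finset.mem_coe.2 (Finset.mem_image.2 ⟨T, Finset.mem_univ T, hT⟩)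
  · rintro ⟨σ, k⟩ hq ⟨τ, l⟩ hr heq
    simp only [Finset.coe_product, Set.mem_prod, Finset.mem_coe, Finset.mem_filter,
      Finset.mem_univ, and_true] at hq hr
    have hkl : k = l := by
      have := congrFun heq v
      simp only [Pi.add_apply, Pi.sub_apply, Pi.single_eq_same, hxv, hq.2, hr.2] at this
      have h2 : ∑ u, x k u = ∑ u, x l u := by
        zify; simpa using this
      rw [hxsum, hxsum] at h2
      exact Fin.ext h2
    subst hkl
    exact Prod.ext (add_right_cancel heq) rfl

open Classical in
theorem sum_bankrupt_eq_sum_scoreMass [Fintype V] (π : N.State → ℝ) (v : V) :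
    ∑ S : N.State with S.Bankrupt v, π S =
      ∑ σ ∈ N.scores.filter (fun σ => σ v = 0), scoreMass π σ := by
  rw [← Finset.sum_fiberwise_of_maps_to (g := State.score)
    (t := N.scores.filter (fun σ => σ v = 0))]
  · refine Finset.sum_congr rfl fun σ hσ => ?_
    rw [scoreMass, ← Finset.sum_filter, Finset.filter_filter]
    refine Finset.sum_congr (Finset.filter_congr fun S _ => ?_) fun _ _ => rfl
    refine and_iff_right_of_imp fun h => State.bankrupt_of_score_eq_zero ?_
    rw [h]
    exact (Finset.mem_filter.1 hσ).2
  · intro S hS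
    exact Finset.mem_filter.2 ⟨Finset.mem_image_of_mem _ (Finset.mem_univ S),
      (Finset.mem_filter.1 hS).2.score_eq_zero⟩

theorem sum_eq_sum_scoreMass [Fintype V] (π : N.State → ℝ) :
    ∑ S, π S = ∑ σ ∈ N.scores, scoreMass π σ := by
  classical
  rw [← Finset.sum_fiberwise_of_maps_to (g := State.score) (t := N.scores)
    fun S hS => Finset.mem_image_of_mem _ hS]
  exact Finset.sum_congr rfl fun σ _ => by rw [scoreMass, ← Finset.sum_filter]

end CreditNetwork

open Classical in
theorem mainTheorem3 {V : Type*} [Fintype V] (N : CreditNetwork V) (R : N.Routing)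
    (Λ : Matrix V V ℝ) (hΛ : IsTransactionMatrix Λ) (hsymm : Λ.IsSymm)
    (herg : IsErgodicChain (R.transitionMatrix Λ)) (v : V) :
    (∃! π : N.State → ℝ, IsSteadyState (R.transitionMatrix Λ) π) ∧
    ∀ π : N.State → ℝ, IsSteadyState (R.transitionMatrix Λ) π →
      ∑ S : N.State with S.Bankrupt v, π S ≤ 1 / ((N.totalCapacity v : ℝ) + 1) := by
  have hne := N.nonempty_state
  have hP := herg.irreducible
  have h1 := R.transitionMatrix_mulVec_one hΛ
  obtain ⟨ρ, hρ⟩ := exists_isSteadyState hP.nonneg h1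
  refine ⟨⟨ρ, hρ, fun π hπ => hπ.unique hP h1 hρ⟩, fun π hπ => ?_⟩
  obtain ⟨S₀⟩ := hne
  -- Uniformity on scores: a harmonic function of an irreducible chain is constant.
  have hconst : ∀ σ ∈ N.scores,
      CreditNetwork.scoreMass π σ = CreditNetwork.scoreMass π S₀.score := fun σ hσ => by
    obtain ⟨S, -, rfl⟩ := Finset.mem_image.1 hσ
    exact hP.eq_of_mulVec_eq_self h1 (R.scoreMass_harmonic hsymm hπ.stationary) S S₀
  have htot := hπ.mem_stdSimplex.2
  -- The number of scores times their common mass is one, so only the counting bound remains.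
  rw [CreditNetwork.sum_eq_sum_scoreMass, Finset.sum_congr rfl hconst, Finset.sum_const,
    nsmul_eq_mul] at htot
  rw [CreditNetwork.sum_bankrupt_eq_sum_scoreMass,
    Finset.sum_congr rfl fun σ hσ => hconst σ (Finset.mem_filter.1 hσ).1, Finset.sum_const,
    nsmul_eq_mul, le_div_iff₀ (by positivity), mul_right_comm]
  refine le_of_le_of_eq ?_ htot
  refine mul_le_mul_of_nonneg_right ?_ (Finset.sum_nonneg fun S _ => ?_)
  · exact_mod_cast N.card_scores_bankrupt_mul_le v
  · split_ifs
    · exact hπ.mem_stdSimplex.1 S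
    · exact le_rfl
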